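/- Let \(\mathbb S=\mathbb S^3\) be the unit sphere of \(\mathbb C^2\cong\mathbb R^4\), with surface measure \(\sigma\), and identify \(z=(x+\imath y,\,u+\imath v)\) with \((x,y,u,v)\), so that \(\imath z\) is the unit tangent vector \((-y,x,-v,u)\) at \(z\). For each \(k\ge 0\) let \(\Phi_{k,1},\dots,\Phi_{k,d_k}\), \(d_k=(k+1)^2\), be a basis, orthonormal in \(L^2(\mathbb S)\), of the space of spherical harmonics of degree \(k\) on \(\mathbb S\), that is, of the restrictions to \(\mathbb S\) of the real homogeneous harmonic polynomials of degree \(k\) on \(\mathbb R^4\) (they satisfy \(\Delta_{\mathbb S}\Phi_{k,j}=-k(k+2)\Phi_{k,j}\)). Let \(U\in W^{1,2}(\mathbb S)\) be real valued, let \(\nabla U\) be its (weak, tangential) gradient on \(\mathbb S\), and let \(a_{k,j}=\int_{\mathbb S}U\,\Phi_{k,j}\,d\sigma\) be the coefficients of \(U\) in its expansion \(\sum_{k}\sum_{j}a_{k,j}\Phi_{k,j}\). Then the series \(\sum_{k}\sum_{j}k\,a_{k,j}^2\) converges, and \[ \|\nabla U\|_{L^2(\mathbb S)}^2-\|\langle\nabla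 U,\imath z\rangle\|_{L^2(\mathbb S)}^2\;\ge\;2\sum_{k=0}^\infty\sum_{j=1}^{d_k}k\,a_{k,j}^2 . \] -/

import Mathlib

open MeasureTheory

noncomputable section

namespace HopfSphere

/-- `ℝ⁴`, identified with `ℂ²` through `(x, y, u, v) ↔ (x + i y, u + i v)`. -/
abbrev R4 : Type := EuclideanSpace ℝ (Fin 4)

/-- The unit sphere `𝕊³` of `ℂ² ≅ ℝ⁴`. -/
abbrev S3 : Type := Metric.sphere (0 : R4) 1

/-- The surface measure of `𝕊³` (of total mass `2 π²`). -/
abbrev surf : Measure S3 := (volume : Measure R4).toSphere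

/-- Multiplication by the imaginary unit on `ℂ² ≅ ℝ⁴`:
`i (x, y, u, v) = (-y, x, -v, u)`. -/
def mulI (z : R4) : R4 := !₂[-z 1, z 0, -z 3, z 2]

/-- The identification of `ℝ⁴` with `ℂ²`. -/
def toC2 (z : R4) : EuclideanSpace ℂ (Fin 2) := !₂[⟨z 0, z 1⟩, ⟨z 2, z 3⟩]

/-- `mulI` is multiplication by `i` in the complex coordinates. -/
theorem toC2_mulI (z : R4) : toC2 (mulI z) = Complex.I • toC2 z := by
  ext j
  fin_cases j <;> simp [toC2, mulI, Complex.ext_iff]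

/-! ### Spherical harmonics -/

/-- The Laplacian `∑ᵢ ∂²/∂xᵢ²` on real polynomials in four variables. -/
def polyLaplacian : MvPolynomial (Fin 4) ℝ →ₗ[ℝ] MvPolynomial (Fin 4) ℝ :=
  ∑ i : Fin 4, (MvPolynomial.pderiv i).toLinearMap ∘ₗ (MvPolynomial.pderiv i).toLinearMap

/-- Restriction of a polynomial (as a function on `ℝ⁴`) to the sphere. -/
def restrictToSphere : MvPolynomial (Fin 4) ℝ →ₗ[ℝ] (S3 → ℝ) where
  toFun p := fun z => MvPolynomial.eval (fun i => z.1 i) p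
  map_add' p q := by ext z; simp
  map_smul' c p := by ext z; simp

/-- The spherical harmonics of degree `k`: restrictions to `𝕊³` of the harmonic
homogeneous polynomials of degree `k`. -/
def sphericalHarmonics (k : ℕ) : Submodule ℝ (S3 → ℝ) :=
  (MvPolynomial.homogeneousSubmodule (Fin 4) ℝ k ⊓ LinearMap.ker polyLaplacian).map
    restrictToSphere

/-- The dimension `d_k = (k + 1)²` of the space of spherical harmonics of degree `k` on `𝕊³`. -/
def dimHarm (k : ℕ) : ℕ := (k + 1) ^ 2

/-- For every degree `k`, the functions `Φ k j`, `j = 1, …, d_k`, form an `L²(𝕊³)`-orthonormal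
basis of the space of spherical harmonics of degree `k`. -/
structure IsHarmonicONB (Φ : (k : ℕ) → Fin (dimHarm k) → S3 → ℝ) : Prop where
  orthonormal : ∀ (k : ℕ) (i j : Fin (dimHarm k)),
    ∫ z, Φ k i z * Φ k j z ∂surf = if i = j then 1 else 0
  span_eq : ∀ k : ℕ, Submodule.span ℝ (Set.range (Φ k)) = sphericalHarmonics k

/-! ### The Sobolev space `W^{1,2}(𝕊³)` -/

/-- The tangential divergence at `z ∈ 𝕊³` of a vector field on `ℝ⁴`: the trace of its
derivative over the tangent space `z^⊥`. For a field that is tangent to the sphere this is the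
Riemannian divergence of its restriction to `𝕊³`. -/
def sphereDiv (X : R4 → R4) (z : S3) : ℝ :=
  (∑ i : Fin 4, fderiv ℝ X z.1 (EuclideanSpace.single i 1) i)
    - inner ℝ (fderiv ℝ X z.1 z.1) z.1

/-- `G` is the weak gradient on `𝕊³`, of class `L²`, of the function `U`: it is a tangent field
with `∫ U div X = - ∫ ⟨G, X⟩` for every smooth tangent field `X` on `𝕊³` (every such field is
the restriction of a smooth field on `ℝ⁴`). -/
structure IsWeakGradient (U : S3 → ℝ) (G : S3 → R4) : Prop where
  memLp : MemLp G 2 surf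
  tangent : ∀ᵐ z ∂surf, inner ℝ (G z) z.1 = 0
  integral_mul_div : ∀ X : R4 → R4, ContDiff ℝ (⊤ : ℕ∞) X →
    (∀ z : S3, inner ℝ (X z.1) z.1 = 0) →
    ∫ z, U z * sphereDiv X z ∂surf = - ∫ z, inner ℝ (G z) (X z.1) ∂surf

/-- The Sobolev space `W^{1,2}(𝕊³)`. -/
def MemW12 (U : S3 → ℝ) : Prop :=
  MemLp U 2 surf ∧ ∃ G : S3 → R4, IsWeakGradient U G

end HopfSphere

end

noncomputable section

namespace HopfSphere

/-! ### Skew-symmetric matrices satisfying the `su(2)` relations -/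

section Matrices

open Matrix

variable {n : Type*} [Fintype n]

/-! The sphere is parallelized by three orthonormal rotation fields X₀ = iz, X₁, X₂, so the
left-hand side is ‖X₁U‖² + ‖X₂U‖² (`IsWeakGradient.integral_norm_sq_sub`). These fields preserve
each space of spherical harmonics, are skew-adjoint there, and satisfy [X₂, X₁] = 2X₀ and ∑ Xᵢ² =
-k(k+2) in degree k. Since k(k+2) - k² = 2k, the claim in degree k says that ‖X₀f‖ ≤ k‖f‖: a weight
of X₀ is at most the highest weight k.

`two_mul_le_of_su2_relations` proves this for real skew matrices, with a maximizer of ‖Ax‖² in place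
of weight vectors. `IsHarmonicONB.two_mul_sum_sq_le` applies it to the coefficients of U, because
integration by parts turns the coefficients of XᵢU into a matrix times those of U. Summing over
degrees needs only Bessel's inequality for X₁U and X₂U, not completeness of the harmonics. -/

theorem dotProduct_self_nonneg (x : n → ℝ) : 0 ≤ x ⬝ᵥ x :=
  Finset.sum_nonneg fun _ _ => mul_self_nonneg _

/-- Moving a skew-symmetric matrix from one side of the dot product to the other. -/
theorem mulVec_dotProduct_of_skew {A : Matrix n n ℝ} (hA : Aᵀ = -A) (x y : n → ℝ) :
    (A *ᵥ x) ⬝ᵥ y = -(x ⬝ᵥ (A *ᵥ y)) := by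
  rw [dotProduct_comm, dotProduct_mulVec, ← mulVec_transpose, hA, neg_mulVec, neg_dotProduct,
    dotProduct_comm]

/-- The quadratic form of a matrix attains its maximum on the unit sphere. -/
theorem exists_max_dotProduct_mulVec [Nonempty n] (A : Matrix n n ℝ) :
    ∃ x : n → ℝ, x ⬝ᵥ x = 1 ∧
      ∀ y : n → ℝ, (A *ᵥ y) ⬝ᵥ (A *ᵥ y) ≤ (A *ᵥ x) ⬝ᵥ (A *ᵥ x) * (y ⬝ᵥ y) := by
  classical
  have hsq : ∀ y : EuclideanSpace ℝ n, y.ofLp ⬝ᵥ y.ofLp = ‖y‖ ^ 2 := fun y => by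
    rw [EuclideanSpace.real_norm_sq_eq]
    simp [dotProduct, sq]
  have hcont : Continuous fun y : EuclideanSpace ℝ n => (A *ᵥ y.ofLp) ⬝ᵥ (A *ᵥ y.ofLp) := by
    simp only [dotProduct, mulVec]
    fun_prop
  obtain ⟨x, hx, hmax⟩ := (isCompact_sphere (0 : EuclideanSpace ℝ n) 1).exists_isMaxOn
    (NormedSpace.sphere_nonempty.2 zero_le_one) hcont.continuousOn
  have hx1 : ‖x‖ = 1 := by simpa using hx
  refine ⟨x.ofLp, by rw [hsq, hx1]; norm_num, fun y => ?_⟩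
  by_cases hy : y = 0
  · simp [hy]
  have hn : ‖(WithLp.toLp 2 y : EuclideanSpace ℝ n)‖ ≠ 0 := by
    simpa using hy
  set r := ‖(WithLp.toLp 2 y : EuclideanSpace ℝ n)‖
  have hmem : (r⁻¹ • WithLp.toLp 2 y : EuclideanSpace ℝ n) ∈ Metric.sphere 0 1 := by
    simp [norm_smul, r, inv_mul_cancel₀ hn]
  have h := hmax hmem
  simp only [Set.mem_ofPred_eq, WithLp.ofLp_smul, mulVec_smul, dotProduct_smul, smul_dotProduct,
    smul_eq_mul] at h
  have hyy : y ⬝ᵥ y = r ^ 2 := hsq (WithLp.toLp 2 y)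
  rw [hyy]
  calc (A *ᵥ y) ⬝ᵥ (A *ᵥ y) = (r⁻¹ * (r⁻¹ * (A *ᵥ y) ⬝ᵥ (A *ᵥ y))) * r ^ 2 := by
        field_simp
    _ ≤ _ := by gcongr

/-- In a skew-symmetric representation of `su(2)` with Casimir element `-k (k + 2)`, the
quadratic form of two of the three generators is bounded below by `2 k`. -/
theorem two_mul_le_of_su2_relations [DecidableEq n] {A B C : Matrix n n ℝ} (hA : Aᵀ = -A)
    (hB : Bᵀ = -B) (hC : Cᵀ = -C) (k : ℕ)
    (hcas : A * A + B * B + C * C = -(k * (k + 2) : ℝ) • (1 : Matrix n n ℝ))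
    (hcomm : B * C - C * B = (2 : ℝ) • A) (x : n → ℝ) :
    2 * (k : ℝ) * (x ⬝ᵥ x) ≤ (B *ᵥ x) ⬝ᵥ (B *ᵥ x) + (C *ᵥ x) ⬝ᵥ (C *ᵥ x) := by
  cases isEmpty_or_nonempty n
  · simp [dotProduct]
  have hsum : ∀ y : n → ℝ, (B *ᵥ y) ⬝ᵥ (B *ᵥ y) + (C *ᵥ y) ⬝ᵥ (C *ᵥ y) =
      k * (k + 2) * (y ⬝ᵥ y) - (A *ᵥ y) ⬝ᵥ (A *ᵥ y) := fun y => by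
    have h := congrArg (fun M : Matrix n n ℝ => y ⬝ᵥ (M *ᵥ y)) hcas
    simp only [add_mulVec, dotProduct_add, ← mulVec_mulVec, smul_mulVec, one_mulVec,
      dotProduct_smul, smul_eq_mul] at h
    rw [mulVec_dotProduct_of_skew hA, mulVec_dotProduct_of_skew hB, mulVec_dotProduct_of_skew hC]
    linarith
  have hcross : ∀ f h : n → ℝ, (C *ᵥ f) ⬝ᵥ (B *ᵥ h) - (B *ᵥ f) ⬝ᵥ (C *ᵥ h) =
      2 * ((A *ᵥ h) ⬝ᵥ f) := fun f h => by
    have e := congrArg (fun M : Matrix n n ℝ => f ⬝ᵥ (M *ᵥ h)) hcomm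
    simp only [sub_mulVec, dotProduct_sub, ← mulVec_mulVec, smul_mulVec, dotProduct_smul,
      smul_eq_mul] at e
    rw [mulVec_dotProduct_of_skew hC, mulVec_dotProduct_of_skew hB, dotProduct_comm (A *ᵥ h)]
    linarith
  have hineq : ∀ f h : n → ℝ, 4 * ((A *ᵥ f) ⬝ᵥ h) ≤
      (k * (k + 2) * (f ⬝ᵥ f) - (A *ᵥ f) ⬝ᵥ (A *ᵥ f)) +
      (k * (k + 2) * (h ⬝ᵥ h) - (A *ᵥ h) ⬝ᵥ (A *ᵥ h)) := fun f h => by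
    -- These are the real and imaginary parts of the ladder operator B + iC applied to f + ih.
    have h1 : 0 ≤ (B *ᵥ f - C *ᵥ h) ⬝ᵥ (B *ᵥ f - C *ᵥ h) := dotProduct_self_nonneg _
    have h2 : 0 ≤ (C *ᵥ f + B *ᵥ h) ⬝ᵥ (C *ᵥ f + B *ᵥ h) := dotProduct_self_nonneg _
    simp only [dotProduct_sub, sub_dotProduct, dotProduct_add, add_dotProduct] at h1 h2
    rw [dotProduct_comm (C *ᵥ h) (B *ᵥ f)] at h1
    rw [dotProduct_comm (B *ᵥ h) (C *ᵥ f)] at h2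
    have := hcross f h
    have e : (A *ᵥ h) ⬝ᵥ f = -((A *ᵥ f) ⬝ᵥ h) := by
      rw [mulVec_dotProduct_of_skew hA, dotProduct_comm]
    linarith [hsum f, hsum h]
  obtain ⟨f, hf, hmax⟩ := exists_max_dotProduct_mulVec A
  set s := (A *ᵥ f) ⬝ᵥ (A *ᵥ f)
  have hs : 0 ≤ s := dotProduct_self_nonneg _
  have hsk : s ≤ (k : ℝ) ^ 2 := by
    by_contra! hlt
    have hspos : 0 < s := lt_of_le_of_lt (sq_nonneg (k : ℝ)) hlt
    set m := √s
    have hm : 0 < m := Real.sqrt_pos.2 hspos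
    have hms : m * m = s := Real.mul_self_sqrt hs
    -- Cauchy–Schwarz for f and A²f, as ⟨f, A²f⟩ = -s and f is a unit vector.
    have hAA : s ^ 2 ≤ (A *ᵥ (A *ᵥ f)) ⬝ᵥ (A *ᵥ (A *ᵥ f)) := by
      have h0 : 0 ≤ (A *ᵥ (A *ᵥ f) + s • f) ⬝ᵥ (A *ᵥ (A *ᵥ f) + s • f) :=
        dotProduct_self_nonneg _
      have h1 : s = -(f ⬝ᵥ (A *ᵥ (A *ᵥ f))) := mulVec_dotProduct_of_skew hA _ _
      simp only [dotProduct_add, add_dotProduct, dotProduct_smul, smul_dotProduct,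
        smul_eq_mul, hf] at h0
      rw [dotProduct_comm _ f] at h0
      nlinarith
    -- With h = Af/m, a unit vector, the ladder inequality becomes m(m + 2) ≤ k(k + 2), which is
    -- incompatible with m > k.
    have key := hineq f (m⁻¹ • (A *ᵥ f))
    simp only [mulVec_smul, dotProduct_smul, smul_dotProduct, smul_eq_mul, hf] at key
    change 4 * (m⁻¹ * s) ≤ k * (k + 2) * 1 - s + (k * (k + 2) * (m⁻¹ * (m⁻¹ * s)) -
      m⁻¹ * (m⁻¹ * ((A *ᵥ (A *ᵥ f)) ⬝ᵥ (A *ᵥ (A *ᵥ f))))) at key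
    have e1 : m⁻¹ * s = m := by rw [← hms]; field_simp
    have e2 : m⁻¹ * (m⁻¹ * s ^ 2) = s := by rw [← hms]; field_simp
    have e3 : m⁻¹ * (m⁻¹ * s ^ 2) ≤
        m⁻¹ * (m⁻¹ * ((A *ᵥ (A *ᵥ f)) ⬝ᵥ (A *ᵥ (A *ᵥ f)))) := by gcongr
    rw [e2] at e3
    rw [e1, inv_mul_cancel₀ hm.ne'] at key
    have hkm : (k : ℝ) < m := Real.lt_sqrt_of_sq_lt hlt
    nlinarith [mul_pos hm hm, k.cast_nonneg (α := ℝ)]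
  have hx := hmax x
  have hxx : 0 ≤ x ⬝ᵥ x := dotProduct_self_nonneg _
  rw [hsum]
  nlinarith [mul_le_mul_of_nonneg_right hsk hxx]

end Matrices

/-! ### Rotation invariance of the surface measure -/

section Rotation

open Metric

variable {E : Type*} [NormedAddCommGroup E] [InnerProductSpace ℝ E]

/-- The homeomorphism of the unit sphere induced by a linear isometry. -/
def sphereRotation (e : E ≃ₗᵢ[ℝ] E) : sphere (0 : E) 1 ≃ₜ sphere (0 : E) 1 :=
  e.toHomeomorph.subtype fun x => by simp

@[simp]
theorem coe_sphereRotation (e : E ≃ₗᵢ[ℝ] E) (z : sphere (0 : E) 1) :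
    (sphereRotation e z : E) = e z := rfl

variable [FiniteDimensional ℝ E]

open scoped Pointwise in
/-- The surface measure of the unit sphere is invariant under linear isometries. -/
theorem measurePreserving_sphereRotation [MeasurableSpace E] [BorelSpace E]
    (e : E ≃ₗᵢ[ℝ] E) :
    MeasurePreserving (sphereRotation e) (volume : Measure E).toSphere
      (volume : Measure E).toSphere := by
  refine ⟨(sphereRotation e).continuous.measurable, Measure.ext fun s hs => ?_⟩
  have hpre := (sphereRotation e).continuous.measurable hs
  rw [Measure.map_apply (sphereRotation e).continuous.measurable hs,
    Measure.toSphere_apply' _ hs, Measure.toSphere_apply' _ hpre]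
  congr 1
  -- The surface measure is defined by the volume of the cone over a set, and a linear isometry
  -- commutes with taking cones.
  have hset : Set.Ioo (0 : ℝ) 1 • (Subtype.val '' (sphereRotation e ⁻¹' s) : Set E) =
      e ⁻¹' (Set.Ioo (0 : ℝ) 1 • (Subtype.val '' s : Set E)) := by
    ext x
    simp only [Set.mem_smul, Set.mem_image, Set.mem_preimage]
    constructor
    · rintro ⟨r, hr, _, ⟨y, hy, rfl⟩, rfl⟩
      exact ⟨r, hr, _, ⟨_, hy, rfl⟩, by simp⟩
    · rintro ⟨r, hr, _, ⟨y, hy, rfl⟩, hx⟩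
      refine ⟨r, hr, _, ⟨(sphereRotation e).symm y, by simpa using hy, rfl⟩, e.injective ?_⟩
      rw [← hx, map_smul, ← coe_sphereRotation, Homeomorph.apply_symm_apply]
  rw [hset, e.measurePreserving.measure_preimage_emb e.toHomeomorph.measurableEmbedding]

/-- The one-parameter group of rotations generated by an orthogonal complex structure. -/
def rotationFlow (J : E →L[ℝ] E) (hJn : ∀ z, ‖J z‖ = ‖z‖)
    (hJo : ∀ z, inner ℝ (J z) z = 0) (t : ℝ) : E ≃ₗᵢ[ℝ] E :=
  LinearIsometry.toLinearIsometryEquiv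
    { toLinearMap := Real.cos t • LinearMap.id + Real.sin t • J.toLinearMap
      norm_map' := fun z => by
        have h : ‖Real.cos t • z + Real.sin t • J z‖ ^ 2 = ‖z‖ ^ 2 := by
          rw [norm_add_sq_real, norm_smul, norm_smul, hJn, inner_smul_left, inner_smul_right,
            real_inner_comm, hJo, mul_pow, mul_pow]
          simp only [Real.norm_eq_abs, sq_abs, mul_zero, add_zero]
          rw [← add_mul, Real.cos_sq_add_sin_sq, one_mul]
        simpa using (sq_eq_sq₀ (norm_nonneg _) (norm_nonneg _)).1 h } rfl

theorem rotationFlow_apply (J : E →L[ℝ] E) (hJn : ∀ z, ‖J z‖ = ‖z‖)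
    (hJo : ∀ z, inner ℝ (J z) z = 0) (t : ℝ) (z : E) :
    rotationFlow J hJn hJo t z = Real.cos t • z + Real.sin t • J z := rfl

theorem hasDerivAt_rotationFlow (J : E →L[ℝ] E) (hJ : ∀ z, J (J z) = -z)
    (hJn : ∀ z, ‖J z‖ = ‖z‖) (hJo : ∀ z, inner ℝ (J z) z = 0) (t : ℝ) (z : E) :
    HasDerivAt (fun t => rotationFlow J hJn hJo t z)
      (J (rotationFlow J hJn hJo t z)) t := by
  simp only [rotationFlow_apply, map_add, map_smul, hJ]
  convert ((Real.hasDerivAt_cos t).smul_const z).add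
    ((Real.hasDerivAt_sin t).smul_const (J z)) using 1
  · rfl
  · module

/-- The derivative of a function along a rotation field integrates to zero over the sphere. -/
theorem integral_fderiv_rotation_eq_zero [MeasurableSpace E] [BorelSpace E] (J : E →L[ℝ] E)
    (hJ : ∀ z, J (J z) = -z) (hJn : ∀ z, ‖J z‖ = ‖z‖) (hJo : ∀ z, inner ℝ (J z) z = 0)
    {f : E → ℝ} (hf : ContDiff ℝ 1 f) :
    ∫ z : sphere (0 : E) 1, fderiv ℝ f z (J z) ∂(volume : Measure E).toSphere = 0 := by
  set R := rotationFlow J hJn hJo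
  have hdf : Continuous fun z : E => fderiv ℝ f z (J z) :=
    (hf.continuous_fderiv one_ne_zero).clm_apply J.continuous
  obtain ⟨C, hC⟩ := (isCompact_sphere (0 : E) 1).exists_bound_of_continuousOn hdf.continuousOn
  -- By rotation invariance this integral does not depend on t; its derivative at t = 0 is the
  -- integral to be computed.
  have hconst : ∀ t, ∫ z : sphere (0 : E) 1, f (R t z) ∂(volume : Measure E).toSphere =
      ∫ z : sphere (0 : E) 1, f z ∂(volume : Measure E).toSphere := fun t =>
    (measurePreserving_sphereRotation (R t)).integral_comp
      (sphereRotation (R t)).measurableEmbedding (fun z => f z)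
  have hint : Integrable (fun z : sphere (0 : E) 1 => f (R 0 z)) (volume : Measure E).toSphere :=
    (hf.continuous.comp ((R 0).continuous.comp continuous_subtype_val)).integrable_of_hasCompactSupport
      (HasCompactSupport.of_compactSpace _)
  have key := (hasDerivAt_integral_of_dominated_loc_of_deriv_le (μ := (volume : Measure E).toSphere)
    (F := fun t (z : sphere (0 : E) 1) => f (R t z))
    (F' := fun t (z : sphere (0 : E) 1) => fderiv ℝ f (R t z) (J (R t z)))
    (x₀ := 0) (bound := fun _ => C) (s := Set.univ) Filter.univ_mem
    (Filter.Eventually.of_forall fun t =>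
      (hf.continuous.comp ((R t).continuous.comp continuous_subtype_val)).aestronglyMeasurable)
    hint
    (hdf.comp ((R 0).continuous.comp continuous_subtype_val)).aestronglyMeasurable
    (Filter.Eventually.of_forall fun z t _ => hC _ (by simp))
    (integrable_const C)
    (Filter.Eventually.of_forall fun z t _ =>
      ((hf.differentiable one_ne_zero (R t z)).hasFDerivAt).comp_hasDerivAt t
        (hasDerivAt_rotationFlow J hJ hJn hJo t z))).2
  simp only [hconst] at key
  have h0 : ∀ z : E, R 0 z = z := fun z => by simp [R, rotationFlow_apply]
  simpa only [h0] using key.unique (hasDerivAt_const _ _)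

end Rotation

/-! ### The quaternionic frame acting on polynomials -/

section Frame

open MvPolynomial

/-- The coordinates of the three rotation fields on `ℝ⁴` that form a parallelization of the
sphere; the first one is multiplication by the imaginary unit. -/
def framePoly : Fin 3 → Fin 4 → MvPolynomial (Fin 4) ℝ :=
  ![![-X 1, X 0, -X 3, X 2], ![-X 2, X 3, X 0, -X 1], ![-X 3, -X 2, X 1, X 0]]

/-- The derivations of the polynomial ring along the three rotation fields. -/
def frameDeriv (i : Fin 3) :
    Derivation ℝ (MvPolynomial (Fin 4) ℝ) (MvPolynomial (Fin 4) ℝ) :=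
  mkDerivation ℝ (framePoly i)

@[simp]
theorem frameDeriv_X (i : Fin 3) (j : Fin 4) : frameDeriv i (X j) = framePoly i j :=
  mkDerivation_X _ _ _

theorem frameDeriv_eq_sum (i : Fin 3) (p : MvPolynomial (Fin 4) ℝ) :
    frameDeriv i p = ∑ j, framePoly i j * pderiv j p := by
  have h : frameDeriv i = framePoly i 0 • pderiv (R := ℝ) 0 + framePoly i 1 • pderiv 1 +
      framePoly i 2 • pderiv 2 + framePoly i 3 • pderiv 3 := by
    refine derivation_ext fun j => ?_
    fin_cases j <;> simp [pderiv_X]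
  rw [h, Fin.sum_univ_four]
  simp

theorem pderiv_comm (i j : Fin 4) (p : MvPolynomial (Fin 4) ℝ) :
    pderiv i (pderiv j p) = pderiv j (pderiv i p) := by
  have h : ⁅pderiv (R := ℝ) i, pderiv (R := ℝ) j⁆ = 0 := by
    refine derivation_ext fun l => ?_
    rw [Derivation.commutator_apply]
    simp only [pderiv_X, Pi.single_apply]
    split_ifs <;> simp
  have := congrArg (fun D => D p) h
  rw [Derivation.commutator_apply] at this
  exact sub_eq_zero.1 this

/-- A commutator of derivations is a derivation, so it suffices to compare both sides on the
coordinates. The order 2, 1 is the one giving the sign +2. -/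
theorem frameDeriv_commutator (p : MvPolynomial (Fin 4) ℝ) :
    frameDeriv 2 (frameDeriv 1 p) - frameDeriv 1 (frameDeriv 2 p) = 2 * frameDeriv 0 p := by
  have h : ⁅frameDeriv 2, frameDeriv 1⁆ = (2 : ℝ) • frameDeriv 0 := by
    refine derivation_ext fun l => ?_
    rw [Derivation.commutator_apply]
    fin_cases l <;> simp [framePoly, two_smul] <;> ring
  have := congrArg (fun D => D p) h
  rw [Derivation.commutator_apply] at this
  simpa [two_smul, two_mul] using this

theorem polyLaplacian_apply (p : MvPolynomial (Fin 4) ℝ) :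
    polyLaplacian p = ∑ i, pderiv i (pderiv i p) := by
  simp [polyLaplacian]

theorem polyLaplacian_frameDeriv (i : Fin 3) (p : MvPolynomial (Fin 4) ℝ) :
    polyLaplacian (frameDeriv i p) = frameDeriv i (polyLaplacian p) := by
  simp only [polyLaplacian_apply, frameDeriv_eq_sum, Fin.sum_univ_four, map_add, pderiv_mul]
  simp only [pderiv_comm 1 0, pderiv_comm 2 0, pderiv_comm 3 0, pderiv_comm 2 1, pderiv_comm 3 1,
    pderiv_comm 3 2]
  fin_cases i <;> simp [framePoly, pderiv_X] <;> ring

theorem isHomogeneous_frameDeriv (i : Fin 3) {k : ℕ} {p : MvPolynomial (Fin 4) ℝ}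
    (hp : p.IsHomogeneous k) : (frameDeriv i p).IsHomogeneous k := by
  have hq : ∀ j, (framePoly i j).IsHomogeneous 1 := fun j => by
    fin_cases i <;> fin_cases j <;>
      first | exact isHomogeneous_X _ _ | exact (isHomogeneous_X _ _).neg
  -- Partial derivatives lower the degree by one and the linear coefficients restore it; for k = 0
  -- there is no degree to lower, so constants are treated apart.
  rcases k with _ | k
  · rw [← totalDegree_zero_iff_isHomogeneous, totalDegree_eq_zero_iff_eq_C] at hp
    rw [hp, ← algebraMap_eq, Derivation.map_algebraMap]
    exact isHomogeneous_zero _ _ _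
  · rw [frameDeriv_eq_sum]
    refine IsHomogeneous.sum _ _ _ fun j _ => ?_
    rw [add_comm]
    exact (hq j).mul hp.pderiv

/-- The sum of the squares of the frame fields, in terms of the Laplacian and the degree. -/
theorem sum_frameDeriv_sq {k : ℕ} {p : MvPolynomial (Fin 4) ℝ} (hp : p.IsHomogeneous k) :
    ∑ i, frameDeriv i (frameDeriv i p) =
      (∑ j, X j ^ 2) * polyLaplacian p - (k * (k + 2) : ℝ) • p := by
  have e := hp.sum_X_mul_pderiv
  rw [Fin.sum_univ_four, ← Nat.cast_smul_eq_nsmul ℝ, smul_eq_C_mul] at e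
  -- With E = ∑ xⱼ∂ⱼ, the sum of squares is |x|²Δ - E² - 2E. Euler's identity Ep = kp and its
  -- derivatives evaluate E² + 2E as k(k + 2).
  have e0 := congrArg (pderiv 0) e
  have e1 := congrArg (pderiv 1) e
  have e2 := congrArg (pderiv 2) e
  have e3 := congrArg (pderiv 3) e
  simp only [polyLaplacian_apply, frameDeriv_eq_sum, Fin.sum_univ_four, Fin.sum_univ_three,
    map_add, pderiv_mul, smul_eq_C_mul] at e0 e1 e2 e3 ⊢
  simp only [pderiv_comm 1 0, pderiv_comm 2 0, pderiv_comm 3 0, pderiv_comm 2 1, pderiv_comm 3 1,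
    pderiv_comm 3 2] at e0 e1 e2 e3 ⊢
  have h2 : (C 2 : MvPolynomial (Fin 4) ℝ) = 2 := map_ofNat C 2
  simp only [framePoly, pderiv_X, map_natCast, map_mul, map_add, h2] at e e0 e1 e2 e3 ⊢
  simp at e e0 e1 e2 e3 ⊢
  linear_combination -X 0 * e0 - X 1 * e1 - X 2 * e2 - X 3 * e3 -
    ((k : MvPolynomial (Fin 4) ℝ) + 2) * e

end Frame

/-! ### The frame fields on the sphere -/

section Fields

open MvPolynomial

/-- The three rotation fields on `ℝ⁴`, as linear maps. -/
def frameField (i : Fin 3) : R4 →L[ℝ] R4 :=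
  LinearMap.toContinuousLinearMap
    { toFun := fun z => WithLp.toLp 2 fun j => eval z.ofLp (framePoly i j)
      map_add' := fun z w => by
        ext j
        fin_cases i <;> fin_cases j <;> simp [framePoly] <;> ring
      map_smul' := fun c z => by
        ext j
        fin_cases i <;> fin_cases j <;> simp [framePoly] }

theorem frameField_apply (i : Fin 3) (z : R4) (j : Fin 4) :
    frameField i z j = eval z.ofLp (framePoly i j) := rfl

theorem frameField_zero (z : R4) : frameField 0 z = mulI z := by
  ext j
  fin_cases j <;> simp [frameField_apply, framePoly, mulI]

theorem frameField_frameField (i : Fin 3) (z : R4) : frameField i (frameField i z) = -z := by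
  ext j
  fin_cases i <;> fin_cases j <;> simp [frameField_apply, framePoly]

theorem norm_frameField (i : Fin 3) (z : R4) : ‖frameField i z‖ = ‖z‖ := by
  rw [EuclideanSpace.norm_eq, EuclideanSpace.norm_eq]
  congr 1
  fin_cases i <;> simp [Fin.sum_univ_four, frameField_apply, framePoly] <;> ring

theorem inner_frameField_self (i : Fin 3) (z : R4) : inner ℝ (frameField i z) z = 0 := by
  fin_cases i <;>
    simp [PiLp.inner_apply, Fin.sum_univ_four, frameField_apply, framePoly] <;> ring

/-- At a point of the sphere the frame fields together with the normal form an orthonormal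
basis. -/
theorem norm_sq_eq_sum_inner_frameField (w : R4) (z : S3) :
    ‖w‖ ^ 2 = inner ℝ w z.1 ^ 2 + ∑ i, inner ℝ w (frameField i z.1) ^ 2 := by
  have hz : ∑ j, z.1 j ^ 2 = 1 := by
    rw [← EuclideanSpace.real_norm_sq_eq, norm_eq_of_mem_sphere]
    norm_num
  rw [EuclideanSpace.real_norm_sq_eq]
  -- Multiplying by |z|² = 1 turns the claim into Euler's four-square identity, which is polynomial.
  refine (mul_one _).symm.trans ((congrArg (fun t => (∑ j, w j ^ 2) * t) hz.symm).trans ?_)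
  simp [PiLp.inner_apply, Fin.sum_univ_four, Fin.sum_univ_three, frameField_apply, framePoly]
  ring

/-- The derivative of a polynomial function on `ℝ⁴`. -/
theorem hasFDerivAt_eval (p : MvPolynomial (Fin 4) ℝ) (z : R4) :
    HasFDerivAt (fun z : R4 => eval z.ofLp p)
      (∑ j, eval z.ofLp (pderiv j p) • (EuclideanSpace.proj j : R4 →L[ℝ] ℝ)) z := by
  induction p using MvPolynomial.induction_on with
  | C a => simpa using hasFDerivAt_const a z
  | add p q hp hq =>
    simp only [map_add, add_smul, Finset.sum_add_distrib]
    exact hp.add hq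
  | mul_X p i hp =>
    have hX : HasFDerivAt (fun z : R4 => z.ofLp i) (EuclideanSpace.proj i : R4 →L[ℝ] ℝ) z :=
      (EuclideanSpace.proj i : R4 →L[ℝ] ℝ).hasFDerivAt
    have h := hp.mul hX
    simp only [map_mul, eval_X]
    refine h.congr_fderiv ?_
    simp only [pderiv_mul, pderiv_X, map_add, map_mul, eval_X, add_smul, Finset.sum_add_distrib,
      Finset.smul_sum, smul_smul]
    rw [add_comm]
    congr 1
    · simp only [mul_comm]
    · rw [Finset.sum_eq_single i]
      · simp
      · intro j _ hj
        simp [hj.symm]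
      · simp

theorem contDiff_eval (p : MvPolynomial (Fin 4) ℝ) {n : WithTop ℕ∞} :
    ContDiff ℝ n fun z : R4 => eval z.ofLp p := by
  simp only [eval_eq]
  fun_prop

theorem fderiv_eval_frameField (i : Fin 3) (p : MvPolynomial (Fin 4) ℝ) (z : R4) :
    fderiv ℝ (fun z : R4 => eval z.ofLp p) z (frameField i z) =
      eval z.ofLp (frameDeriv i p) := by
  rw [(hasFDerivAt_eval p z).fderiv, frameDeriv_eq_sum, map_sum]
  simp [frameField_apply, mul_comm]

theorem restrictToSphere_apply (p : MvPolynomial (Fin 4) ℝ) (z : S3) :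
    restrictToSphere p z = eval z.1.ofLp p := rfl

theorem restrictToSphere_mul (p q : MvPolynomial (Fin 4) ℝ) (z : S3) :
    restrictToSphere (p * q) z = restrictToSphere p z * restrictToSphere q z :=
  map_mul (eval z.1.ofLp) p q

theorem continuous_restrictToSphere (p : MvPolynomial (Fin 4) ℝ) :
    Continuous (restrictToSphere p) :=
  (contDiff_eval (n := 0) p).continuous.comp continuous_subtype_val

theorem integrable_restrictToSphere (p : MvPolynomial (Fin 4) ℝ) :
    Integrable (restrictToSphere p) surf :=
  (continuous_restrictToSphere p).integrable_of_hasCompactSupport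
    (HasCompactSupport.of_compactSpace _)

theorem memLp_restrictToSphere (p : MvPolynomial (Fin 4) ℝ) :
    MemLp (restrictToSphere p) 2 surf :=
  (continuous_restrictToSphere p).memLp_of_hasCompactSupport
    (HasCompactSupport.of_compactSpace _)

theorem integral_frameDeriv (i : Fin 3) (p : MvPolynomial (Fin 4) ℝ) :
    ∫ z, restrictToSphere (frameDeriv i p) z ∂surf = 0 := by
  have h := integral_fderiv_rotation_eq_zero (frameField i) (frameField_frameField i)
    (norm_frameField i) (inner_frameField_self i) (contDiff_eval p)
  simp only [fderiv_eval_frameField] at h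
  exact h

/-- The frame derivations are skew-adjoint. -/
theorem integral_frameDeriv_mul (i : Fin 3) (p q : MvPolynomial (Fin 4) ℝ) :
    ∫ z, restrictToSphere (frameDeriv i p) z * restrictToSphere q z ∂surf =
      -∫ z, restrictToSphere p z * restrictToSphere (frameDeriv i q) z ∂surf := by
  have h := integral_frameDeriv i (p * q)
  simp only [Derivation.leibniz, smul_eq_mul, map_add, Pi.add_apply] at h
  rw [integral_add (integrable_restrictToSphere _) (integrable_restrictToSphere _)] at h
  simp only [restrictToSphere_mul] at h
  simp only [mul_comm (restrictToSphere q _)] at h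
  linarith

/-- The linear field has trace zero and is tangent, so only the derivative of the coefficient p
along it survives. -/
theorem sphereDiv_smul_frameField (i : Fin 3) (p : MvPolynomial (Fin 4) ℝ) (z : S3) :
    sphereDiv (fun z => eval z.ofLp p • frameField i z) z =
      restrictToSphere (frameDeriv i p) z := by
  have hd : HasFDerivAt (fun z : R4 => eval z.ofLp p • frameField i z) _ z.1 :=
    (hasFDerivAt_eval p z.1).smul (frameField i).hasFDerivAt
  rw [sphereDiv, hd.fderiv, restrictToSphere_apply, frameDeriv_eq_sum]
  simp only [add_apply, smul_apply,
    ContinuousLinearMap.smulRight_apply, inner_add_left, real_inner_smul_left,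
    inner_frameField_self, mul_zero, add_zero, sub_zero, sum_apply]
  fin_cases i <;> simp [Fin.sum_univ_four, frameField_apply, framePoly] <;> ring

/-- Weak differentiation along a frame field. -/
theorem IsWeakGradient.integral_mul_frameDeriv {U : S3 → ℝ} {G : S3 → R4}
    (hG : IsWeakGradient U G) (i : Fin 3) (p : MvPolynomial (Fin 4) ℝ) :
    ∫ z, U z * restrictToSphere (frameDeriv i p) z ∂surf =
      -∫ z, inner ℝ (G z) (frameField i z.1) * restrictToSphere p z ∂surf := by
  have h := hG.integral_mul_div (fun z => eval z.ofLp p • frameField i z)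
    ((contDiff_eval p).smul (frameField i).contDiff)
    (fun z => by rw [real_inner_smul_left, inner_frameField_self, mul_zero])
  simp only [sphereDiv_smul_frameField, real_inner_smul_right] at h
  rw [h]
  simp only [restrictToSphere_apply, mul_comm]

theorem IsWeakGradient.memLp_inner_frameField {U : S3 → ℝ} {G : S3 → R4}
    (hG : IsWeakGradient U G) (i : Fin 3) :
    MemLp (fun z => inner ℝ (G z) (frameField i z.1)) 2 surf := by
  refine hG.memLp.of_le (hG.memLp.aestronglyMeasurable.inner
    ((frameField i).continuous.comp continuous_subtype_val).aestronglyMeasurable)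
    (Filter.Eventually.of_forall fun z => ?_)
  refine (norm_inner_le_norm _ _).trans_eq ?_
  rw [norm_frameField, norm_eq_of_mem_sphere, mul_one]

/-- The energy without the component along the Hopf fibres. -/
theorem IsWeakGradient.integral_norm_sq_sub {U : S3 → ℝ} {G : S3 → R4}
    (hG : IsWeakGradient U G) :
    (∫ z, ‖G z‖ ^ 2 ∂surf) - ∫ z, (inner ℝ (G z) (mulI z.1)) ^ 2 ∂surf =
      (∫ z, (inner ℝ (G z) (frameField 1 z.1)) ^ 2 ∂surf) +
        ∫ z, (inner ℝ (G z) (frameField 2 z.1)) ^ 2 ∂surf := by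
  have hi := fun i => (hG.memLp_inner_frameField i).integrable_sq
  have h : ∫ z, ‖G z‖ ^ 2 ∂surf = ∫ z, ((inner ℝ (G z) (frameField 0 z.1)) ^ 2 +
      (inner ℝ (G z) (frameField 1 z.1)) ^ 2 + (inner ℝ (G z) (frameField 2 z.1)) ^ 2) ∂surf := by
    refine integral_congr_ae ?_
    filter_upwards [hG.tangent] with z hz
    rw [norm_sq_eq_sum_inner_frameField, hz, Fin.sum_univ_three]
    ring
  have h01 : Integrable (fun z => (inner ℝ (G z) (frameField 0 z.1)) ^ 2 +
      (inner ℝ (G z) (frameField 1 z.1)) ^ 2) surf := (hi 0).add (hi 1)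
  rw [h, integral_add h01 (hi 2), integral_add (hi 0) (hi 1)]
  simp only [frameField_zero]
  ring

end Fields

/-! ### Bessel's inequality for an orthonormal family of functions -/

section Bessel

variable {α ι : Type*} [MeasurableSpace α] {μ : Measure α}

theorem inner_toLp_eq_integral {f g : α → ℝ} (hf : MemLp f 2 μ) (hg : MemLp g 2 μ) :
    inner ℝ (hf.toLp f) (hg.toLp g) = ∫ z, g z * f z ∂μ := by
  rw [L2.inner_def]
  refine integral_congr_ae ?_
  filter_upwards [hf.coeFn_toLp, hg.coeFn_toLp] with z h1 h2
  simp [h1, h2]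

/-- Bessel's inequality in `L²`, stated with integrals. -/
theorem summable_and_tsum_integral_mul_sq_le [DecidableEq ι] {e : ι → α → ℝ}
    (he : ∀ i, MemLp (e i) 2 μ)
    (horth : ∀ i j, ∫ z, e i z * e j z ∂μ = if i = j then 1 else 0)
    {g : α → ℝ} (hg : MemLp g 2 μ) :
    Summable (fun i => (∫ z, g z * e i z ∂μ) ^ 2) ∧
      ∑' i, (∫ z, g z * e i z ∂μ) ^ 2 ≤ ∫ z, g z ^ 2 ∂μ := by
  have hon : Orthonormal ℝ fun i => (he i).toLp (e i) := by
    rw [orthonormal_iff_ite]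
    intro i j
    rw [inner_toLp_eq_integral, horth]
    exact if_congr eq_comm rfl rfl
  have hs := hon.inner_products_summable (hg.toLp g)
  have hle := hon.tsum_inner_products_le (hg.toLp g)
  simp only [inner_toLp_eq_integral, Real.norm_eq_abs, sq_abs] at hs hle
  refine ⟨hs, hle.trans_eq ?_⟩
  rw [← real_inner_self_eq_norm_sq, inner_toLp_eq_integral]
  simp only [sq]

end Bessel

/-! ### Spherical harmonics of different degrees -/

section Harmonics

open MvPolynomial

theorem mem_sphericalHarmonics {k : ℕ} {f : S3 → ℝ} :
    f ∈ sphericalHarmonics k ↔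
      ∃ p : MvPolynomial (Fin 4) ℝ, p.IsHomogeneous k ∧ polyLaplacian p = 0 ∧
        restrictToSphere p = f := by
  simp [sphericalHarmonics, Submodule.mem_map, and_assoc, mem_homogeneousSubmodule]

theorem integrable_restrictToSphere_mul (p q : MvPolynomial (Fin 4) ℝ) :
    Integrable (fun z => restrictToSphere p z * restrictToSphere q z) surf :=
  (memLp_restrictToSphere p).integrable_mul (memLp_restrictToSphere q)

/-- The frame derivations preserve the harmonic polynomials of a given degree. -/
theorem restrictToSphere_frameDeriv_mem {k : ℕ} {p : MvPolynomial (Fin 4) ℝ}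
    (hp : p.IsHomogeneous k) (hΔ : polyLaplacian p = 0) (i : Fin 3) :
    restrictToSphere (frameDeriv i p) ∈ sphericalHarmonics k :=
  mem_sphericalHarmonics.2 ⟨_, isHomogeneous_frameDeriv i hp,
    by rw [polyLaplacian_frameDeriv, hΔ, map_zero], rfl⟩

/-- The Casimir operator of the frame acts on spherical harmonics by `-k (k + 2)`. -/
theorem sum_restrictToSphere_frameDeriv_sq {k : ℕ} {p : MvPolynomial (Fin 4) ℝ}
    (hp : p.IsHomogeneous k) (hΔ : polyLaplacian p = 0) :
    ∑ i, restrictToSphere (frameDeriv i (frameDeriv i p)) =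
      -(k * (k + 2) : ℝ) • restrictToSphere p := by
  rw [← map_sum, sum_frameDeriv_sq hp, hΔ, mul_zero, zero_sub, map_neg, map_smul, neg_smul]

/-- The Casimir identity after integration by parts. The left side is symmetric in p and q while
only p must be harmonic of degree k; comparing two degrees therefore gives orthogonality. -/
theorem sum_integral_frameDeriv_mul_frameDeriv {k : ℕ} {p : MvPolynomial (Fin 4) ℝ}
    (hp : p.IsHomogeneous k) (hΔ : polyLaplacian p = 0) (q : MvPolynomial (Fin 4) ℝ) :
    ∑ i, ∫ z, restrictToSphere (frameDeriv i p) z * restrictToSphere (frameDeriv i q) z ∂surf =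
      k * (k + 2) * ∫ z, restrictToSphere p z * restrictToSphere q z ∂surf := by
  have h : ∀ z, ∑ i, restrictToSphere (frameDeriv i (frameDeriv i p)) z * restrictToSphere q z =
      -(k * (k + 2) : ℝ) * (restrictToSphere p z * restrictToSphere q z) := fun z => by
    rw [← Finset.sum_mul, ← Finset.sum_apply, sum_restrictToSphere_frameDeriv_sq hp hΔ,
      Pi.smul_apply, smul_eq_mul, mul_assoc]
  have h2 := congrArg (fun f : S3 → ℝ => ∫ z, f z ∂surf) (funext h)
  simp only [integral_const_mul] at h2
  rw [integral_finsetSum _ fun i _ => integrable_restrictToSphere_mul _ _] at h2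
  simp only [integral_frameDeriv_mul _ (frameDeriv _ _), Finset.sum_neg_distrib] at h2
  linarith

/-- Spherical harmonics of different degrees are orthogonal. -/
theorem integral_mul_eq_zero_of_degree_ne {k l : ℕ} (hkl : k ≠ l) {f g : S3 → ℝ}
    (hf : f ∈ sphericalHarmonics k) (hg : g ∈ sphericalHarmonics l) :
    ∫ z, f z * g z ∂surf = 0 := by
  obtain ⟨p, hp, hpΔ, rfl⟩ := mem_sphericalHarmonics.1 hf
  obtain ⟨q, hq, hqΔ, rfl⟩ := mem_sphericalHarmonics.1 hg
  have h1 := sum_integral_frameDeriv_mul_frameDeriv hp hpΔ q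
  have h2 := sum_integral_frameDeriv_mul_frameDeriv hq hqΔ p
  simp only [mul_comm (restrictToSphere (frameDeriv _ q) _), mul_comm (restrictToSphere q _)] at h2
  rw [h1] at h2
  by_contra hne
  have h3 : (k * (k + 2) : ℝ) = l * (l + 2) := mul_right_cancel₀ hne h2
  have h4 : k * (k + 2) = l * (l + 2) := by exact_mod_cast h3
  exact hkl (by nlinarith [lt_trichotomy k l])

theorem memLp_of_mem_sphericalHarmonics {k : ℕ} {f : S3 → ℝ} (hf : f ∈ sphericalHarmonics k) :
    MemLp f 2 surf := by
  obtain ⟨p, -, -, rfl⟩ := mem_sphericalHarmonics.1 hf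
  exact memLp_restrictToSphere p

/-! ### Expansion in the basis and the estimate in a fixed degree -/

namespace IsHarmonicONB

variable {Φ : (k : ℕ) → Fin (dimHarm k) → S3 → ℝ}

theorem mem (hΦ : IsHarmonicONB Φ) (k : ℕ) (j : Fin (dimHarm k)) :
    Φ k j ∈ sphericalHarmonics k :=
  hΦ.span_eq k ▸ Submodule.subset_span ⟨j, rfl⟩

theorem memLp (hΦ : IsHarmonicONB Φ) (k : ℕ) (j : Fin (dimHarm k)) : MemLp (Φ k j) 2 surf :=
  memLp_of_mem_sphericalHarmonics (hΦ.mem k j)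

theorem integral_mul_eq_ite (hΦ : IsHarmonicONB Φ) (s t : Σ k, Fin (dimHarm k)) :
    ∫ z, Φ s.1 s.2 z * Φ t.1 t.2 z ∂surf = if s = t then 1 else 0 := by
  obtain ⟨k, i⟩ := s
  obtain ⟨l, j⟩ := t
  by_cases hkl : k = l
  · subst hkl
    simp [hΦ.orthonormal]
  · rw [if_neg fun h => hkl (congrArg Sigma.fst h)]
    exact integral_mul_eq_zero_of_degree_ne hkl (hΦ.mem k i) (hΦ.mem l j)

/-- The expansion of a spherical harmonic in the orthonormal basis of its degree. -/
theorem eq_sum (hΦ : IsHarmonicONB Φ) {k : ℕ} {f : S3 → ℝ} (hf : f ∈ sphericalHarmonics k)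
    (z : S3) : f z = ∑ j, (∫ w, Φ k j w * f w ∂surf) * Φ k j z := by
  rw [← hΦ.span_eq, Submodule.mem_span_range_iff_exists_fun] at hf
  obtain ⟨c, rfl⟩ := hf
  have hc : ∀ j, ∫ w, Φ k j w * (∑ i, c i • Φ k i) w ∂surf = c j := fun j => by
    simp only [Finset.sum_apply, Pi.smul_apply, smul_eq_mul, Finset.mul_sum, mul_left_comm _ (c _)]
    have hi : ∀ i, Integrable (fun w => Φ k j w * Φ k i w) surf := fun i =>
      (hΦ.memLp k j).integrable_mul (hΦ.memLp k i)
    rw [integral_finsetSum _ fun i _ => (hi i).const_mul (c i)]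
    simp [integral_const_mul, hΦ.orthonormal]
  simp only [hc]
  simp

theorem integral_mul_eq_sum (hΦ : IsHarmonicONB Φ) {k : ℕ} {f U : S3 → ℝ}
    (hf : f ∈ sphericalHarmonics k) (hU : MemLp U 2 surf) :
    ∫ z, U z * f z ∂surf =
      ∑ j, (∫ z, Φ k j z * f z ∂surf) * ∫ z, U z * Φ k j z ∂surf := by
  have h : ∀ z, U z * f z = ∑ j, (∫ w, Φ k j w * f w ∂surf) * (U z * Φ k j z) := fun z => by
    conv_lhs => rw [hΦ.eq_sum hf z, Finset.mul_sum]
    exact Finset.sum_congr rfl fun j _ => by ring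
  have hi : ∀ j, Integrable (fun z => U z * Φ k j z) surf := fun j =>
    hU.integrable_mul (hΦ.memLp k j)
  simp only [h]
  rw [integral_finsetSum _ fun j _ => (hi j).const_mul _]
  simp only [integral_const_mul]

/-- A choice of harmonic polynomials that restrict to the given basis. -/
theorem exists_poly (hΦ : IsHarmonicONB Φ) (k : ℕ) :
    ∃ P : Fin (dimHarm k) → MvPolynomial (Fin 4) ℝ, ∀ j, (P j).IsHomogeneous k ∧
      polyLaplacian (P j) = 0 ∧ restrictToSphere (P j) = Φ k j := by
  choose P hP using fun j => mem_sphericalHarmonics.1 (hΦ.mem k j)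
  exact ⟨P, hP⟩

/-- The part of degree `k` of the two horizontal derivatives of `U` dominates `2 k` times the
part of degree `k` of `U`. -/
theorem two_mul_sum_sq_le (hΦ : IsHarmonicONB Φ) {U : S3 → ℝ} (hU : MemLp U 2 surf)
    {G : S3 → R4} (hG : IsWeakGradient U G) (k : ℕ) :
    2 * ∑ j, (k : ℝ) * (∫ z, U z * Φ k j z ∂surf) ^ 2 ≤
      ∑ j, (∫ z, inner ℝ (G z) (frameField 1 z.1) * Φ k j z ∂surf) ^ 2 +
        ∑ j, (∫ z, inner ℝ (G z) (frameField 2 z.1) * Φ k j z ∂surf) ^ 2 := by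
  obtain ⟨P, hP⟩ := hΦ.exists_poly k
  have hr : ∀ j, Φ k j = restrictToSphere (P j) := fun j => (hP j).2.2.symm
  have hD : ∀ i j, restrictToSphere (frameDeriv i (P j)) ∈ sphericalHarmonics k := fun i j =>
    restrictToSphere_frameDeriv_mem (hP j).1 (hP j).2.1 i
  let M : Fin 3 → Matrix (Fin (dimHarm k)) (Fin (dimHarm k)) ℝ := fun i =>
    Matrix.of fun l j => ∫ z, Φ k l z * restrictToSphere (frameDeriv i (P j)) z ∂surf
  have hskew : ∀ i l j, M i l j = -M i j l := fun i l j => by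
    simp only [M, Matrix.of_apply]
    rw [hr, hr, ← integral_frameDeriv_mul]
    simp only [mul_comm]
  -- The frame preserves degree k, so the expansion in the basis is exact and matrix products
  -- represent compositions.
  have hmul : ∀ i i' l j, (M i * M i') l j =
      ∫ z, Φ k l z * restrictToSphere (frameDeriv i (frameDeriv i' (P j))) z ∂surf := by
    intro i i' l j
    have h := hΦ.integral_mul_eq_sum (hD i' j) (memLp_restrictToSphere (frameDeriv i (P l)))
    rw [hr l, ← neg_inj, ← integral_frameDeriv_mul, h, Matrix.mul_apply, ← Finset.sum_neg_distrib]
    refine Finset.sum_congr rfl fun m _ => ?_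
    rw [hskew i l m, neg_mul, neg_neg, mul_comm]
    simp only [M, Matrix.of_apply, mul_comm]
  have hM : ∀ i, (M i).transpose = -M i := fun i => by
    ext l j
    exact hskew i j l
  have hcas : M 0 * M 0 + M 2 * M 2 + M 1 * M 1 =
      -(k * (k + 2) : ℝ) • (1 : Matrix (Fin (dimHarm k)) (Fin (dimHarm k)) ℝ) := by
    ext l j
    have h := sum_integral_frameDeriv_mul_frameDeriv (hP j).1 (hP j).2.1 (P l)
    have hsq : ∀ i, (M i * M i) l j = -∫ z, restrictToSphere (frameDeriv i (P j)) z *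
        restrictToSphere (frameDeriv i (P l)) z ∂surf := fun i => by
      rw [hmul, hr l, ← neg_inj, ← integral_frameDeriv_mul, neg_neg]
      simp only [mul_comm]
    rw [← hr j, ← hr l, hΦ.orthonormal, Fin.sum_univ_three] at h
    simp only [Matrix.add_apply, hsq, Matrix.smul_apply, Matrix.one_apply, smul_eq_mul,
      eq_comm (a := l)]
    linarith
  have hcomm : M 2 * M 1 - M 1 * M 2 = (2 : ℝ) • M 0 := by
    ext l j
    have h : ∀ z, Φ k l z * restrictToSphere (frameDeriv 2 (frameDeriv 1 (P j))) z -
        Φ k l z * restrictToSphere (frameDeriv 1 (frameDeriv 2 (P j))) z =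
        2 * (Φ k l z * restrictToSphere (frameDeriv 0 (P j)) z) := fun z => by
      rw [← mul_sub, ← Pi.sub_apply, ← map_sub, frameDeriv_commutator, two_mul, map_add,
        Pi.add_apply]
      ring
    rw [Matrix.sub_apply, hmul, hmul, hr l,
      ← integral_sub (integrable_restrictToSphere_mul _ _) (integrable_restrictToSphere_mul _ _),
      ← hr l]
    simp only [h, integral_const_mul]
    rfl
  -- The minus sign of the weak derivative cancels the one from skew-symmetry of `M i`.
  have hb : ∀ i j, ∫ z, inner ℝ (G z) (frameField i z.1) * Φ k j z ∂surf =
      (M i).mulVec (fun l => ∫ z, U z * Φ k l z ∂surf) j := fun i j => by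
    rw [hr j, ← neg_inj, ← hG.integral_mul_frameDeriv, hΦ.integral_mul_eq_sum (hD i j) hU,
      Matrix.mulVec, dotProduct, ← Finset.sum_neg_distrib]
    refine Finset.sum_congr rfl fun l _ => ?_
    rw [hskew i j l, neg_mul, neg_neg]
    rfl
  have key := two_mul_le_of_su2_relations (hM 0) (hM 2) (hM 1) k hcas hcomm
    (fun l => ∫ z, U z * Φ k l z ∂surf)
  simp only [hb]
  simp only [dotProduct, ← sq] at key
  rw [← Finset.mul_sum, ← mul_assoc]
  linarith

end IsHarmonicONB

end Harmonics

end HopfSphere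

end

/-! ### Summation over all degrees -/

theorem lemma4p1
    (Φ : (k : ℕ) → Fin (HopfSphere.dimHarm k) → HopfSphere.S3 → ℝ)
    (hΦ : HopfSphere.IsHarmonicONB Φ)
    (U : HopfSphere.S3 → ℝ) (hU : HopfSphere.MemW12 U)
    (gradU : HopfSphere.S3 → HopfSphere.R4) (hgrad : HopfSphere.IsWeakGradient U gradU)
    (a : (k : ℕ) → Fin (HopfSphere.dimHarm k) → ℝ)
    (ha : ∀ k j, a k j = ∫ z, U z * Φ k j z ∂HopfSphere.surf) :
    Summable (fun k : ℕ => ∑ j, (k : ℝ) * a k j ^ 2) ∧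
    (∫ z, ‖gradU z‖ ^ 2 ∂HopfSphere.surf)
        - (∫ z, (inner ℝ (gradU z) (HopfSphere.mulI z.1)) ^ 2 ∂HopfSphere.surf)
      ≥ 2 * ∑' k : ℕ, ∑ j, (k : ℝ) * a k j ^ 2 := by
  classical
  have bessel := fun i => HopfSphere.summable_and_tsum_integral_mul_sq_le
    (fun s : Σ k, Fin (HopfSphere.dimHarm k) => hΦ.memLp s.1 s.2) hΦ.integral_mul_eq_ite
    (hgrad.memLp_inner_frameField i)
  have hsum := fun i => (bessel i).1.sigma
  have hle := fun i => (bessel i).2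
  simp only [(bessel _).1.tsum_sigma] at hle
  simp only [tsum_fintype] at hsum hle
  have hdeg := fun k => hΦ.two_mul_sum_sq_le hU.1 hgrad k
  simp only [← ha] at hdeg
  -- The degreewise bound by the Bessel series of X₁U and X₂U yields both the convergence and, after
  -- summation, the inequality.
  have hs2 : Summable fun k : ℕ => 2 * ∑ j, (k : ℝ) * a k j ^ 2 :=
    Summable.of_nonneg_of_le (fun k => by positivity) hdeg ((hsum 1).add (hsum 2))
  have hs : Summable fun k : ℕ => ∑ j, (k : ℝ) * a k j ^ 2 :=
    (summable_mul_left_iff two_ne_zero).1 hs2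
  refine ⟨hs, ?_⟩
  rw [hgrad.integral_norm_sq_sub, ← tsum_mul_left]
  have h := hs2.tsum_le_tsum hdeg ((hsum 1).add (hsum 2))
  rw [(hsum 1).tsum_add (hsum 2)] at h
  exact h.trans (add_le_add (hle 1) (hle 2))
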